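/- There are absolute constants $K > 1$ and $\delta > 0$ such that the following holds for all positive integers $n, d$ with $600 \le d \le n/K$ and $nd$ even. Let $\alpha = 1/12$, let $G$ be chosen uniformly at random from the set of all simple $d$-regular graphs on the vertex set $V = \{1, \dots, n\}$, and let $Q$ be the event that there is a non-empty set $S \subseteq V$ with $|S| \le n/15$ that spans at least $\alpha d |S|$ edges, that is, such that at least $\alpha d|S|$ edges of $G$ have both endpoints in $S$. Then $\Pr(Q) \le n^{-\delta}$. Equivalently, with probability at least $1 - n^{-\delta}$, no non-empty vertex set of size at most $n/15$ spans $\alpha d|S|$ or more edges. -/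

import Mathlib

open Finset

/-- The set of all (labelled, simple) `d`-regular graphs on the vertex set `{0, …, n - 1}`. -/
noncomputable def regularGraphs (n d : ℕ) : Finset (SimpleGraph (Fin n)) :=
  open Classical in Finset.univ.filter fun G => G.IsRegularOfDegree d

/-- The probability that a graph chosen uniformly at random among all `d`-regular graphs on
`n` labelled vertices lies in `Q`
(used only for `n * d` even and `d < n`, when there are such graphs). -/
noncomputable def randomRegularProb (n d : ℕ) (Q : Set (SimpleGraph (Fin n))) : ℝ :=
  open Classical in
  (((regularGraphs n d).filter fun G => G ∈ Q).card : ℝ) / ((regularGraphs n d).card : ℝ)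

/-- The set `E(S)` of edges spanned by `S`: the edges of `G` with both endpoints in `S`. -/
noncomputable def spannedEdges {n : ℕ} (G : SimpleGraph (Fin n)) (S : Finset (Fin n)) :
    Finset (Sym2 (Fin n)) :=
  open Classical in G.edgeFinset.filter fun e => ∀ v ∈ e, v ∈ S

/-- The event that some non-empty vertex set `S` with `|S| ≤ n / 15` spans at least
`α d |S|` edges. -/
def smallDenseSetEvent (n d : ℕ) (α : ℝ) : Set (SimpleGraph (Fin n)) :=
  {G | ∃ S : Finset (Fin n), S.Nonempty ∧ (S.card : ℝ) ≤ (n : ℝ) / 15 ∧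
    α * (d : ℝ) * (S.card : ℝ) ≤ ((spannedEdges G S).card : ℝ)}

/-! Switching shows that each further prescribed edge costs a factor at most `10d/(9n)`, so `j`
given edges all occur with probability at most `(10d/(9n))^j` while `j` is small against `nd`. For
`|S| = k`, this bounds the mean number of `j`-subsets of `E(S)`, with `j = 16k`. If `e(S) ≥ dk/12`,
there are at least `(dk/18)^j / j!` such subsets, so by Markov the probability is at most
`(10k/n)^j`. Keeping `j` well below `e(S)` avoids the factor of about `e` per edge lost by
prescribing all `dk/12` edges, which is too much at `k = n/15`. The union over the `k`-sets then
costs `(en/k)^k`, leaving `(k/n)^k`, and these terms sum to at most `2/n`. -/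

/-- The `d`-regular graphs on `n` labelled vertices all of whose edges include the pairs in `H`. -/
noncomputable def regularGraphsContaining (n d : ℕ) (H : Finset (Sym2 (Fin n))) :
    Finset (SimpleGraph (Fin n)) :=
  open Classical in (regularGraphs n d).filter fun G => ∀ e ∈ H, e ∈ G.edgeSet

open Classical in
theorem mem_regularGraphs {n d : ℕ} {G : SimpleGraph (Fin n)} :
    G ∈ regularGraphs n d ↔ ∀ v, (univ.filter fun w => G.Adj v w).card = d := by
  rw [regularGraphs, mem_filter, and_iff_right (mem_univ G), SimpleGraph.IsRegularOfDegree]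
  refine forall_congr' fun v => ?_
  rw [← SimpleGraph.card_neighborFinset_eq_degree, SimpleGraph.neighborFinset_eq_filter]

theorem mem_regularGraphsContaining {n d : ℕ} {H : Finset (Sym2 (Fin n))}
    {G : SimpleGraph (Fin n)} :
    G ∈ regularGraphsContaining n d H ↔ G ∈ regularGraphs n d ∧ ∀ e ∈ H, e ∈ G.edgeSet := by
  simp [regularGraphsContaining]

/-! ### Switchings -/

/-- The `4`-cycle `u v y x`. -/
def fourCycle {V : Type*} (u v x y : V) : SimpleGraph V :=
  SimpleGraph.fromEdgeSet {s(u, v), s(v, y), s(y, x), s(x, u)}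

/-- The switching that exchanges the edges `uv`, `xy` for `ux`, `vy`. -/
def switchEdges {V : Type*} (G : SimpleGraph V) (u v x y : V) : SimpleGraph V :=
  symmDiff G (fourCycle u v x y)

/-- The edges `xy` of `G` along which the edge `uv` can be switched. -/
def Switchable {V : Type*} (G : SimpleGraph V) (u v x y : V) : Prop :=
  G.Adj u v ∧ G.Adj x y ∧ x ≠ u ∧ y ≠ v ∧ ¬ G.Adj u x ∧ ¬ G.Adj v y

theorem Switchable.ne {V : Type*} {G : SimpleGraph V} {u v x y : V} (h : Switchable G u v x y) :
    u ≠ v ∧ x ≠ y ∧ x ≠ u ∧ y ≠ v ∧ x ≠ v ∧ y ≠ u := by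
  obtain ⟨h1, h2, h3, h4, h5, h6⟩ := h
  refine ⟨h1.ne, h2.ne, h3, h4, ?_, ?_⟩
  · rintro rfl; exact h5 h1
  · rintro rfl; exact h6 h1.symm

theorem Switchable.adj_switchEdges_iff {V : Type*} {G : SimpleGraph V} {u v x y : V}
    (h : Switchable G u v x y) (a b : V) :
    (switchEdges G u v x y).Adj a b ↔
      (G.Adj a b ∧ s(a, b) ≠ s(u, v) ∧ s(a, b) ≠ s(x, y)) ∨ s(a, b) = s(u, x) ∨
        s(a, b) = s(v, y) := by
  obtain ⟨n1, n2, n3, n4, n5, n6⟩ := h.ne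
  obtain ⟨h1, h2, h3, h4, h5, h6⟩ := h
  have h1' := h1.symm
  have h2' := h2.symm
  have h5' : ¬ G.Adj x u := fun h => h5 h.symm
  have h6' : ¬ G.Adj y v := fun h => h6 h.symm
  simp only [switchEdges, fourCycle, symmDiff_def, SimpleGraph.sup_adj, SimpleGraph.sdiff_adj,
    SimpleGraph.fromEdgeSet_adj, Set.mem_insert_iff, Set.mem_singleton_iff, Sym2.eq_iff, ne_eq]
  grind

open Classical in
theorem Switchable.switchEdges_mem_regularGraphs {n d : ℕ} {G : SimpleGraph (Fin n)}
    {u v x y : Fin n} (h : Switchable G u v x y) (hG : G ∈ regularGraphs n d) :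
    switchEdges G u v x y ∈ regularGraphs n d := by
  rw [mem_regularGraphs] at hG ⊢
  intro w
  have key := h.adj_switchEdges_iff w
  obtain ⟨n1, n2, n3, n4, n5, n6⟩ := h.ne
  obtain ⟨h1, h2, h3, h4, h5, h6⟩ := h
  have h1' := h1.symm
  have h2' := h2.symm
  have h5' : ¬ G.Adj x u := fun h => h5 h.symm
  have h6' : ¬ G.Adj y v := fun h => h6 h.symm
  rw [← hG w]
  -- Each vertex of the cycle trades one neighbour `a` for one new neighbour `b`.
  have swap : ∀ a b, G.Adj w a → ¬ G.Adj w b →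
      (∀ c, (switchEdges G u v x y).Adj w c ↔ c = b ∨ (c ≠ a ∧ G.Adj w c)) →
      (univ.filter fun c => (switchEdges G u v x y).Adj w c).card =
        (univ.filter fun c => G.Adj w c).card := by
    intro a b ha hb hc
    have : (univ.filter fun c => (switchEdges G u v x y).Adj w c) =
        insert b ((univ.filter fun c => G.Adj w c).erase a) := by
      ext c; simp [hc]
    have ha' : a ∈ univ.filter fun c => G.Adj w c := by simpa using ha
    rw [this, card_insert_of_notMem (by simp [hb]), card_erase_add_one ha']
  simp only [Sym2.eq_iff, ne_eq] at key
  by_cases wu : w = u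
  · subst wu; exact swap v x h1 h5 fun c => by rw [key]; grind
  by_cases wv : w = v
  · subst wv; exact swap u y h1' h6 fun c => by rw [key]; grind
  by_cases wx : w = x
  · subst wx; exact swap y u h2 h5' fun c => by rw [key]; grind
  by_cases wy : w = y
  · subst wy; exact swap x v h2' h6' fun c => by rw [key]; grind
  congr 1
  ext c
  simp only [mem_filter, mem_univ, true_and]
  rw [key]; grind

/-! ### The cost of a prescribed edge -/

open Classical in
theorem card_adj_pairs_fst {n d : ℕ} {G : SimpleGraph (Fin n)} (hG : G ∈ regularGraphs n d)
    (A : Finset (Fin n)) :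
    (univ.filter fun p : Fin n × Fin n => G.Adj p.1 p.2 ∧ p.1 ∈ A).card = A.card * d := by
  rw [mem_regularGraphs] at hG
  have : (univ.filter fun p : Fin n × Fin n => G.Adj p.1 p.2 ∧ p.1 ∈ A) =
      A.biUnion fun a => (univ.filter fun w => G.Adj a w).map ⟨Prod.mk a, Prod.mk_right_injective a⟩ := by
    ext ⟨a, b⟩; simp [and_comm]
  rw [this, card_biUnion]
  · simp [hG]
  · intro a _ b _ hab
    simp only [Function.onFun, disjoint_left, mem_map, Function.Embedding.coeFn_mk]
    rintro _ ⟨_, _, rfl⟩ ⟨_, _, h⟩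
    exact hab (congrArg Prod.fst h).symm

open Classical in
theorem card_adj_pairs_snd {n d : ℕ} {G : SimpleGraph (Fin n)} (hG : G ∈ regularGraphs n d)
    (A : Finset (Fin n)) :
    (univ.filter fun p : Fin n × Fin n => G.Adj p.1 p.2 ∧ p.2 ∈ A).card = A.card * d := by
  rw [← card_adj_pairs_fst hG A]
  refine card_bij (fun p _ => p.swap) ?_ ?_ ?_
  · rintro ⟨a, b⟩; simp [G.adj_comm]
  · intro a _ b _ h; exact Prod.swap_injective h
  · rintro ⟨a, b⟩ h; exact ⟨(b, a), by simpa [G.adj_comm] using h, rfl⟩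

theorem card_pairs_mk_mem_le {V : Type*} [Fintype V] [DecidableEq V] (H : Finset (Sym2 V)) :
    (univ.filter fun p : V × V => s(p.1, p.2) ∈ H).card ≤ 2 * H.card := by
  refine card_le_mul_card_image_of_maps_to (f := fun p : V × V => s(p.1, p.2)) (t := H)
    (fun p hp => (mem_filter.1 hp).2) 2 ?_
  intro e _
  induction e using Sym2.ind with
  | _ a b =>
    refine (card_le_card (t := {(a, b), (b, a)}) ?_).trans card_le_two
    rintro ⟨c, e⟩
    simp

-- Of the `n * d` ordered edges, one that is excluded lies in `H`, starts in `{u} ∪ N(u)` or ends in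
-- `{v} ∪ N(v)`.
open Classical in
theorem le_card_switchable {n d : ℕ} {G : SimpleGraph (Fin n)} (hG : G ∈ regularGraphs n d)
    {u v : Fin n} (huv : G.Adj u v) (H : Finset (Sym2 (Fin n))) :
    n * d ≤ (univ.filter fun p : Fin n × Fin n =>
      Switchable G u v p.1 p.2 ∧ s(p.1, p.2) ∉ H).card + 2 * H.card + 2 * ((d + 1) * d) := by
  have hN := mem_regularGraphs.1 hG
  have hall := card_adj_pairs_fst hG univ
  simp only [mem_univ, and_true, card_univ, Fintype.card_fin] at hall
  have h1 := card_adj_pairs_fst hG (insert u (univ.filter fun w => G.Adj u w))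
  have h2 := card_adj_pairs_snd hG (insert v (univ.filter fun w => G.Adj v w))
  rw [card_insert_of_notMem (by simp), hN] at h1 h2
  have h3 := card_pairs_mk_mem_le H
  rw [← hall]
  have hsub : (univ.filter fun p : Fin n × Fin n => G.Adj p.1 p.2) ⊆
      ((univ.filter fun p : Fin n × Fin n => Switchable G u v p.1 p.2 ∧ s(p.1, p.2) ∉ H) ∪
      (univ.filter fun p : Fin n × Fin n => s(p.1, p.2) ∈ H)) ∪
      ((univ.filter fun p : Fin n × Fin n =>
        G.Adj p.1 p.2 ∧ p.1 ∈ insert u (univ.filter fun w => G.Adj u w)) ∪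
      (univ.filter fun p : Fin n × Fin n =>
        G.Adj p.1 p.2 ∧ p.2 ∈ insert v (univ.filter fun w => G.Adj v w))) := by
    rintro ⟨a, b⟩ hab
    simp only [mem_union, mem_filter, mem_univ, true_and, mem_insert] at hab ⊢
    unfold Switchable
    tauto
  have := (card_le_card hsub).trans (card_union_le _ _)
  have h4 := card_union_le
    (univ.filter fun p : Fin n × Fin n => Switchable G u v p.1 p.2 ∧ s(p.1, p.2) ∉ H)
    (univ.filter fun p : Fin n × Fin n => s(p.1, p.2) ∈ H)
  have h5 := card_union_le (univ.filter fun p : Fin n × Fin n =>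
        G.Adj p.1 p.2 ∧ p.1 ∈ insert u (univ.filter fun w => G.Adj u w))
      (univ.filter fun p : Fin n × Fin n =>
        G.Adj p.1 p.2 ∧ p.2 ∈ insert v (univ.filter fun w => G.Adj v w))
  omega

-- Double counting: a switching removes `uv` but keeps `H`, and in the new graph `x`, `y` are
-- neighbours of `u`, `v`, leaving `d * d` choices. Given `(x, y)`, the symmetric difference can be
-- undone.
open Classical in
theorem sum_card_switchable_le {n d : ℕ} {u v : Fin n} {H : Finset (Sym2 (Fin n))}
    (hH : s(u, v) ∉ H) :
    ∑ G ∈ regularGraphsContaining n d (insert s(u, v) H),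
      (univ.filter fun p : Fin n × Fin n => Switchable G u v p.1 p.2 ∧ s(p.1, p.2) ∉ H).card ≤
    (regularGraphsContaining n d H).card * (d * d) := by
  have hR : (regularGraphsContaining n d H).card * (d * d) =
      ∑ G ∈ regularGraphsContaining n d H,
        ((univ.filter fun w => G.Adj u w) ×ˢ (univ.filter fun w => G.Adj v w)).card := by
    rw [← smul_eq_mul, ← sum_const]
    refine sum_congr rfl fun G hG => ?_
    have := mem_regularGraphs.1 (mem_regularGraphsContaining.1 hG).1
    rw [card_product, this, this]
  rw [hR, ← card_sigma, ← card_sigma]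
  refine card_le_card_of_injOn (fun q => ⟨switchEdges q.1 u v q.2.1 q.2.2, q.2⟩) ?_ ?_
  · rintro ⟨G, x, y⟩ hq
    simp only [coe_sigma, Set.mem_sigma_iff, mem_coe, mem_filter, mem_univ, true_and,
      mem_regularGraphsContaining, mem_product] at hq ⊢
    obtain ⟨⟨hG, hGH⟩, hs, hxy⟩ := hq
    refine ⟨⟨hs.switchEdges_mem_regularGraphs hG, fun e he => ?_⟩, ?_, ?_⟩
    · have heG := hGH e (mem_insert_of_mem he)
      induction e using Sym2.ind with
      | _ a b =>
        rw [SimpleGraph.mem_edgeSet] at heG ⊢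
        rw [hs.adj_switchEdges_iff]
        refine Or.inl ⟨heG, ?_, ?_⟩
        · intro h; exact hH (h ▸ he)
        · intro h; exact hxy (h ▸ he)
    · rw [hs.adj_switchEdges_iff]; simp
    · rw [hs.adj_switchEdges_iff]; simp
  · rintro ⟨G, x, y⟩ _ ⟨G', x', y'⟩ _ h
    simp only [Sigma.mk.injEq, heq_eq_eq, Prod.mk.injEq] at h
    obtain ⟨h, rfl, rfl⟩ := h
    have : G = G' := symmDiff_left_injective _ h
    rw [this]

/-- One more prescribed edge costs a factor `10 d / (9 n)`. -/
theorem card_regularGraphsContaining_insert_le {n d : ℕ} {e : Sym2 (Fin n)}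
    {H : Finset (Sym2 (Fin n))} (he : e ∉ H)
    (hF : (9 / 10 : ℝ) * (n * d) + 2 * H.card + 2 * ((d + 1) * d) ≤ n * d) (hn : 0 < n)
    (hd : 0 < d) :
    ((regularGraphsContaining n d (insert e H)).card : ℝ) ≤
      10 * d / (9 * n) * (regularGraphsContaining n d H).card := by
  classical
  induction e using Sym2.ind with
  | _ u v =>
    have hle := sum_card_switchable_le (d := d) he
    have hlow : ∀ G ∈ regularGraphsContaining n d (insert s(u, v) H), (9 / 10 : ℝ) * (n * d) ≤
        ((univ.filter fun p : Fin n × Fin n =>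
          Switchable G u v p.1 p.2 ∧ s(p.1, p.2) ∉ H).card : ℝ) := by
      intro G hG
      rw [mem_regularGraphsContaining] at hG
      have huv : G.Adj u v := hG.2 _ (mem_insert_self _ _)
      have := le_card_switchable hG.1 huv H
      have h' : (n * d : ℝ) ≤ ((univ.filter fun p : Fin n × Fin n =>
          Switchable G u v p.1 p.2 ∧ s(p.1, p.2) ∉ H).card : ℝ) + 2 * H.card +
          2 * ((d + 1) * d) := by exact_mod_cast this
      linarith
    have h1 := sum_le_sum hlow
    rw [sum_const, nsmul_eq_mul] at h1
    have h2 : (∑ G ∈ regularGraphsContaining n d (insert s(u, v) H),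
      ((univ.filter fun p : Fin n × Fin n =>
        Switchable G u v p.1 p.2 ∧ s(p.1, p.2) ∉ H).card : ℝ)) ≤
      (regularGraphsContaining n d H).card * (d * d) := by exact_mod_cast hle
    have h3 := h1.trans h2
    have hn' : (0 : ℝ) < n := by exact_mod_cast hn
    have hd' : (0 : ℝ) < d := by exact_mod_cast hd
    rw [div_mul_eq_mul_div, le_div_iff₀ (by positivity)]
    refine le_of_mul_le_mul_right ?_ hd'
    linarith

theorem card_regularGraphsContaining_le {n d : ℕ} (H : Finset (Sym2 (Fin n)))
    (hF : (9 / 10 : ℝ) * (n * d) + 2 * H.card + 2 * ((d + 1) * d) ≤ n * d) (hn : 0 < n)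
    (hd : 0 < d) :
    ((regularGraphsContaining n d H).card : ℝ) ≤
      (10 * d / (9 * n)) ^ H.card * (regularGraphs n d).card := by
  classical
  induction H using Finset.induction_on with
  | empty => simp [regularGraphsContaining]
  | insert e H he ih =>
    rw [card_insert_of_notMem he] at hF ⊢
    push_cast at hF
    have hF' : (9 / 10 : ℝ) * (n * d) + 2 * H.card + 2 * ((d + 1) * d) ≤ n * d := by linarith
    refine (card_regularGraphsContaining_insert_le he hF' hn hd).trans ?_
    rw [pow_succ', mul_assoc]
    exact mul_le_mul_of_nonneg_left (ih hF') (by positivity)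

/-! ### Edges spanned by a fixed set -/

open Classical in
theorem spannedEdges_subset {n : ℕ} (G : SimpleGraph (Fin n)) (S : Finset (Fin n)) :
    spannedEdges G S ⊆ S.sym2.filter fun e => ¬ e.IsDiag := by
  intro e he
  simp only [spannedEdges, mem_filter, SimpleGraph.mem_edgeFinset, mem_sym2_iff] at he ⊢
  exact ⟨he.2, G.not_isDiag_of_mem_edgeSet he.1⟩

open Classical in
theorem sum_choose_card_spannedEdges_le {n d : ℕ} (S : Finset (Fin n)) (j : ℕ)
    (hF : (9 / 10 : ℝ) * (n * d) + 2 * j + 2 * ((d + 1) * d) ≤ n * d) (hn : 0 < n)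
    (hd : 0 < d) :
    (∑ G ∈ regularGraphs n d, ((spannedEdges G S).card.choose j : ℝ)) ≤
      (S.card.choose 2).choose j * ((10 * d / (9 * n)) ^ j * (regularGraphs n d).card) := by
  set T := S.sym2.filter fun e => ¬ e.IsDiag with hT
  have hTc : T.card = S.card.choose 2 := by
    rw [← Sym2.card_image_offDiag]
    congr 1
    ext e
    induction e using Sym2.ind with
    | _ a b =>
      simp only [hT, mem_filter, mem_sym2_iff, Sym2.mem_iff, mem_image, mem_offDiag, Prod.exists]
      constructor
      · intro h
        exact ⟨a, b, ⟨h.1 a (by simp), h.1 b (by simp), by simpa using h.2⟩, rfl⟩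
      · rintro ⟨c, e, ⟨h1, h2, h3⟩, h4⟩
        have h4 : s(c, e) = s(a, b) := h4
        rw [← h4]
        rw [Sym2.eq_iff] at h4
        refine ⟨?_, by simpa using h3⟩
        grind
  -- Count pairs of a graph and a `j`-subset of its spanned edges in both orders.
  have hcomm : ∑ G ∈ regularGraphs n d, (spannedEdges G S).card.choose j =
      ∑ H ∈ powersetCard j T, ((regularGraphs n d).filter fun G => H ⊆ spannedEdges G S).card := by
    simp only [card_filter]
    rw [sum_comm]
    refine sum_congr rfl fun G _ => ?_
    rw [← card_filter, ← card_powersetCard]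
    congr 1
    ext H
    simp only [mem_filter, mem_powersetCard]
    have := spannedEdges_subset G S
    constructor
    · rintro ⟨h1, h2⟩; exact ⟨⟨h1.trans this, h2⟩, h1⟩
    · rintro ⟨⟨_, h2⟩, h1⟩; exact ⟨h1, h2⟩
  have hcomm' : (∑ G ∈ regularGraphs n d, ((spannedEdges G S).card.choose j : ℝ)) =
      ∑ H ∈ powersetCard j T,
        (((regularGraphs n d).filter fun G => H ⊆ spannedEdges G S).card : ℝ) := by
    exact_mod_cast hcomm
  rw [hcomm', ← hTc, ← card_powersetCard, ← nsmul_eq_mul]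
  refine sum_le_card_nsmul _ _ _ fun H hH => ?_
  obtain ⟨-, hHj⟩ := mem_powersetCard.1 hH
  subst hHj
  refine le_trans ?_ (card_regularGraphsContaining_le H hF hn hd)
  refine Nat.cast_le.2 (card_le_card fun G hG => ?_)
  rw [mem_filter] at hG
  rw [mem_regularGraphsContaining]
  refine ⟨hG.1, fun e he => ?_⟩
  have := hG.2 he
  simp only [spannedEdges, mem_filter, SimpleGraph.mem_edgeFinset] at this
  exact this.1

-- Markov's inequality for the number of `16k`-subsets of `E(S)`.
open Classical in
theorem card_spannedEdges_ge_le {n d : ℕ} (hd : 600 ≤ d) (hdn : (d : ℝ) ≤ n / 100)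
    (S : Finset (Fin n)) (hS : S.Nonempty) (hSn : (S.card : ℝ) ≤ n / 15) :
    (((regularGraphs n d).filter fun G =>
      (1 / 12 : ℝ) * d * S.card ≤ (spannedEdges G S).card).card : ℝ) ≤
      (10 * S.card / n) ^ (16 * S.card) * (regularGraphs n d).card := by
  set k := S.card with hk
  set j := 16 * k with hj
  have hd' : (600 : ℝ) ≤ d := by exact_mod_cast hd
  have hn' : (0 : ℝ) < n := by linarith
  have hn : 0 < n := by exact_mod_cast hn'
  have hk0 : (0 : ℝ) < k := by exact_mod_cast hS.card_pos
  have hjR : (j : ℝ) = 16 * k := by rw [hj]; push_cast; ring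
  have hF : (9 / 10 : ℝ) * (n * d) + 2 * j + 2 * ((d + 1) * d) ≤ n * d := by
    rw [hjR]
    nlinarith
  have hsum := sum_choose_card_spannedEdges_le (d := d) S j hF hn (by omega)
  have hfact : (0 : ℝ) < j.factorial := by exact_mod_cast j.factorial_pos
  have hup : (j.factorial : ℝ) * (k.choose 2).choose j ≤ ((k : ℝ) * k / 2) ^ j := by
    have h1 : ((k.choose 2 : ℕ) : ℝ) ≤ (k : ℝ) * k / 2 := by
      rw [Nat.cast_choose_two]; nlinarith
    have h2 : (j.factorial : ℝ) * (k.choose 2).choose j ≤ ((k.choose 2 : ℕ) : ℝ) ^ j := by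
      exact_mod_cast (Nat.descFactorial_eq_factorial_mul_choose _ _).symm.le.trans
        (Nat.descFactorial_le_pow _ _)
    exact h2.trans (pow_le_pow_left₀ (by positivity) h1 _)
  have hlow : ∀ G ∈ (regularGraphs n d).filter fun G =>
      (1 / 12 : ℝ) * d * k ≤ (spannedEdges G S).card,
      ((d : ℝ) * k / 18) ^ j ≤ j.factorial * ((spannedEdges G S).card.choose j : ℝ) := by
    intro G hG
    have hE := (mem_filter.1 hG).2
    set E := (spannedEdges G S).card
    -- Since `1/12 - 1/18 = 1/36`, this needs `d ≥ 16 * 36 = 576`.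
    have hbig : (d : ℝ) * k / 18 + j ≤ E := by rw [hjR]; nlinarith
    have hjE : j ≤ E := by
      have : (j : ℝ) ≤ E := by have : (0 : ℝ) ≤ d * k / 18 := by positivity
                               linarith
      exact_mod_cast this
    have h1 : ((E + 1 - j : ℕ) : ℝ) ^ j ≤ j.factorial * (E.choose j : ℝ) := by
      exact_mod_cast (Nat.pow_sub_le_descFactorial E j).trans
        (Nat.descFactorial_eq_factorial_mul_choose _ _).le
    refine le_trans (pow_le_pow_left₀ (by positivity) ?_ _) h1
    rw [Nat.cast_sub (by omega)]; push_cast; linarith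
  have hmain := sum_le_sum hlow
  rw [sum_const, nsmul_eq_mul] at hmain
  have h2 : (∑ G ∈ (regularGraphs n d).filter fun G =>
      (1 / 12 : ℝ) * d * k ≤ (spannedEdges G S).card,
      (j.factorial : ℝ) * ((spannedEdges G S).card.choose j : ℝ)) ≤
      ((k : ℝ) * k / 2) ^ j * ((10 * d / (9 * n)) ^ j * (regularGraphs n d).card) := by
    refine (sum_le_sum_of_subset_of_nonneg (filter_subset _ _)
      fun _ _ _ => by positivity).trans ?_
    rw [← mul_sum]
    refine (mul_le_mul_of_nonneg_left hsum hfact.le).trans ?_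
    rw [← mul_assoc]
    exact mul_le_mul_of_nonneg_right hup (by positivity)
  have h3 := hmain.trans h2
  have hbase : (k : ℝ) * k / 2 * (10 * d / (9 * n)) = 10 * k / n * (d * k / 18) := by
    field_simp; norm_num
  rw [← mul_assoc, ← mul_pow, hbase, mul_pow,
    mul_right_comm _ _ ((regularGraphs n d).card : ℝ)] at h3
  have hpos : 0 < ((d : ℝ) * k / 18) ^ j := by positivity
  exact le_of_mul_le_mul_right h3 hpos

/-! ### Union bound -/

theorem choose_mul_pow_le {n k : ℕ} (hk : 0 < k) (hkn : (k : ℝ) ≤ n / 15) :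
    (n.choose k : ℝ) * (10 * k / n) ^ (16 * k) ≤ (k / n) ^ k := by
  have hk0 : (0 : ℝ) < k := by exact_mod_cast hk
  have hn : (0 : ℝ) < n := by linarith
  have h1 : (n.choose k : ℝ) ≤ n ^ k / k.factorial := Nat.choose_le_pow_div k n
  have h2 : (k : ℝ) ^ k / k.factorial ≤ Real.exp 1 ^ k := by
    rw [← Real.exp_nat_mul, mul_one]
    exact Real.pow_div_factorial_le_exp _ hk0.le _
  have hf : (0 : ℝ) < k.factorial := by exact_mod_cast k.factorial_pos
  have h3 : (n.choose k : ℝ) ≤ (Real.exp 1 * (n / k)) ^ k := by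
    refine h1.trans ?_
    calc (n : ℝ) ^ k / k.factorial = (n / k) ^ k * (k ^ k / k.factorial) := by
          rw [div_pow]; field_simp
      _ ≤ (n / k) ^ k * Real.exp 1 ^ k := by gcongr
      _ = _ := by rw [mul_pow, mul_comm]
  have hx : (k : ℝ) / n ≤ 1 / 15 := by rw [div_le_iff₀ hn]; linarith
  have hx0 : (0 : ℝ) < k / n := by positivity
  refine (mul_le_mul_of_nonneg_right h3 (by positivity)).trans ?_
  rw [pow_mul, ← mul_pow]
  refine pow_le_pow_left₀ (by positivity) ?_ _
  have e1 : (n : ℝ) / k = ((k : ℝ) / n)⁻¹ := by rw [inv_div]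
  rw [e1, mul_div_assoc]
  set x := (k : ℝ) / n
  have h14 : x ^ 14 ≤ (1 / 15) ^ 14 := pow_le_pow_left₀ hx0.le hx _
  have he := Real.exp_one_lt_d9
  -- The exponent 16 is chosen here: `e * 10^16 / 15^14` is about 0.93, whereas `e * 10^15 / 15^13`
  -- exceeds 1.
  calc Real.exp 1 * x⁻¹ * (10 * x) ^ 16 = (Real.exp 1 * 10 ^ 16 * x ^ 14) * x := by field_simp
    _ ≤ (2.7182818286 * 10 ^ 16 * (1 / 15) ^ 14) * x := by gcongr
    _ ≤ 1 * x := by gcongr; norm_num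
    _ = x := one_mul x

/-- One factor supplies `1/n`; its numerator `k ≤ 2^(k-1)` is absorbed by the other `k - 1` factors,
each at most `1/4`. -/
theorem pow_self_div_le {n k : ℕ} (hk : 0 < k) (hkn : (k : ℝ) ≤ n / 15) :
    ((k : ℝ) / n) ^ k ≤ 1 / n * (1 / 2) ^ (k - 1) := by
  obtain ⟨i, rfl⟩ := Nat.exists_eq_succ_of_ne_zero hk.ne'
  have hk0 : (0 : ℝ) < (i.succ : ℕ) := by exact_mod_cast hk
  have hn : (0 : ℝ) < n := by linarith
  have hx : ((i.succ : ℕ) : ℝ) / n ≤ 1 / 15 := by rw [div_le_iff₀ hn]; linarith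
  have h2 : ((i.succ : ℕ) : ℝ) ≤ 2 ^ i := by exact_mod_cast Nat.lt_two_pow_self (n := i)
  rw [Nat.succ_sub_one, pow_succ]
  calc (((i.succ : ℕ) : ℝ) / n) ^ i * (((i.succ : ℕ) : ℝ) / n) ≤
      (1 / 4) ^ i * (2 ^ i / n) := by
        have hx4 : ((i.succ : ℕ) : ℝ) / n ≤ 1 / 4 := by linarith
        exact mul_le_mul (pow_le_pow_left₀ (by positivity) hx4 _)
          (div_le_div_of_nonneg_right h2 hn.le) (by positivity) (by positivity)
    _ = 1 / n * (1 / 2) ^ i := by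
      rw [show (1 / 4 : ℝ) = 1 / 2 * (1 / 2) by norm_num, mul_pow]
      have : (1 / 2 : ℝ) ^ i * 2 ^ i = 1 := by rw [← mul_pow]; norm_num
      linear_combination (1 / 2 : ℝ) ^ i / n * this

theorem card_smallDenseSetEvent_le {n d : ℕ} (hd : 600 ≤ d) (hdn : (d : ℝ) ≤ n / 100) :
    open Classical in
    (((regularGraphs n d).filter fun G => G ∈ smallDenseSetEvent n d (1 / 12)).card : ℝ) ≤
      2 / n * (regularGraphs n d).card := by
  classical
  have hd' : (600 : ℝ) ≤ d := by exact_mod_cast hd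
  have hn : (0 : ℝ) < n := by linarith
  set R := regularGraphs n d
  set m := n / 15 with hm
  have hmn : (m : ℝ) ≤ n / 15 := by
    have := Nat.cast_div_le (α := ℝ) (m := n) (n := 15)
    exact_mod_cast this
  let bad : Finset (Fin n) → Finset (SimpleGraph (Fin n)) := fun S =>
    R.filter fun G => (1 / 12 : ℝ) * d * S.card ≤ (spannedEdges G S).card
  have hsub : R.filter (fun G => G ∈ smallDenseSetEvent n d (1 / 12)) ⊆
      (range m).biUnion fun i => (powersetCard (i + 1) univ).biUnion bad := by
    intro G hG
    obtain ⟨hGR, S, hS, hSn, hE⟩ := mem_filter.1 hG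
    have hSm : S.card ≤ m := by
      rw [hm, Nat.le_div_iff_mul_le (by norm_num)]
      have : (S.card : ℝ) * 15 ≤ n := by linarith
      exact_mod_cast this
    have := hS.card_pos
    simp only [mem_biUnion, mem_range, mem_powersetCard_univ]
    exact ⟨S.card - 1, by omega, S, by omega, mem_filter.2 ⟨hGR, hE⟩⟩
  have hlevel : ∀ i ∈ range m, (((powersetCard (i + 1) univ).biUnion bad).card : ℝ) ≤
      1 / n * (1 / 2) ^ i * R.card := by
    intro i hi
    have hin : ((i + 1 : ℕ) : ℝ) ≤ n / 15 := by
      refine le_trans ?_ hmn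
      exact_mod_cast mem_range.1 hi
    have h1 : (((powersetCard (i + 1) univ).biUnion bad).card : ℝ) ≤
        ∑ S ∈ powersetCard (i + 1) univ, ((bad S).card : ℝ) := by
      exact_mod_cast card_biUnion_le
    have h2 : ∀ S ∈ powersetCard (i + 1) (univ : Finset (Fin n)), ((bad S).card : ℝ) ≤
        (10 * ((i + 1 : ℕ) : ℝ) / n) ^ (16 * (i + 1)) * R.card := by
      intro S hS
      have hc := mem_powersetCard_univ.1 hS
      have := card_spannedEdges_ge_le hd hdn S (card_pos.1 (by omega)) (by rw [hc]; exact hin)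
      rw [← hc]
      exact this
    refine (h1.trans (sum_le_card_nsmul _ _ _ h2)).trans ?_
    rw [card_powersetCard, card_univ, Fintype.card_fin, nsmul_eq_mul, ← mul_assoc]
    refine mul_le_mul_of_nonneg_right ?_ (by positivity)
    exact (choose_mul_pow_le i.succ_pos hin).trans (pow_self_div_le i.succ_pos hin)
  calc ((R.filter fun G => G ∈ smallDenseSetEvent n d (1 / 12)).card : ℝ)
      ≤ ∑ i ∈ range m, (((powersetCard (i + 1) univ).biUnion bad).card : ℝ) := by
        exact_mod_cast (card_le_card hsub).trans card_biUnion_le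
    _ ≤ ∑ i ∈ range m, (1 / n * (1 / 2) ^ i * R.card : ℝ) := sum_le_sum hlevel
    _ = 1 / n * R.card * ∑ i ∈ range m, (1 / 2 : ℝ) ^ i := by
        rw [mul_sum]; exact sum_congr rfl fun _ _ => by ring
    _ ≤ 1 / n * R.card * 2 :=
        mul_le_mul_of_nonneg_left (sum_geometric_two_le m) (by positivity)
    _ = 2 / n * R.card := by ring

theorem mainTheorem9 :
    ∃ K : ℝ, 1 < K ∧ ∃ δ : ℝ, 0 < δ ∧
      ∀ n d : ℕ, 600 ≤ d → (d : ℝ) ≤ (n : ℝ) / K → Even (n * d) →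
        randomRegularProb n d (smallDenseSetEvent n d (1 / 12)) ≤ (n : ℝ) ^ (-δ) := by
  refine ⟨100, by norm_num, 1 / 2, by norm_num, fun n d hd hdn _ => ?_⟩
  have hd' : (600 : ℝ) ≤ d := by exact_mod_cast hd
  have hn : (4 : ℝ) ≤ n := by linarith
  have hn0 : (0 : ℝ) < n := by linarith
  -- With no regular graphs the quotient is `0 / 0 = 0`, so the bound still holds.
  have h1 : randomRegularProb n d (smallDenseSetEvent n d (1 / 12)) ≤ 2 / n :=
    div_le_of_le_mul₀ (by positivity) (by positivity) (card_smallDenseSetEvent_le hd hdn)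
  refine h1.trans ?_
  -- `2/n ≤ n^(-1/2)` amounts to `n ≥ 4`.
  rw [Real.rpow_neg hn0.le, ← Real.sqrt_eq_rpow, div_le_iff₀ hn0, ← div_eq_inv_mul,
    Real.div_sqrt]
  exact Real.le_sqrt_of_sq_le (by linarith)
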